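/- A potential is a measurable function $U:\mathbb{R}\to(-\infty,\infty]$ with $U(x)=U(-x)$ for all $x$ which is finite on a set of positive Lebesgue measure. Let $G=(V,E)$ be a finite connected simple graph with maximal degree $\Delta$, let $V_0\subseteq V$ be non-empty, and let $U$ be a potential with $U(x)\le U(y)$ whenever $0\le x\le y$, and $U(x)=\infty$ for all $x>1$. Let $$d\mu_{U,G,V_0}(\varphi)=\frac1{Z_{U,G,V_0}}\exp\Big(-\sum_{\{v,w\}\in E}U(\varphi_v-\varphi_w)\Big)\prod_{v\in V_0}\delta_0(d\varphi_v)\prod_{v\in V\setminus V_0}d\varphi_v$$ on $\mathbb{R}^V$, where $\delta_0$ is the Dirac measure at $0$, $d\varphi_v$ is Lebesgue measure and $Z_{U,G,V_0}$ is the total mass of the measure without the factor $1/Z_{U,G,V_0}$. Then $\mu_{U,G,V_0}$ is a well-defined probability measure. If $\varphi$ is sampled from it then, for every $0<\varepsilon\le\frac18$, every integer $k\ge0$ and every $k$ distinct edges $\{v_1,w_1\},\dots,\{v_k,w_k\}\in E$, $$\mathbb{P}\big(|\varphi_{v_i}-\varphi_{w_i}|\ge1-\varepsilon\ \text{ for all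 }1\le i\le k\big)\le\big(C(\Delta)\,\delta(U,\varepsilon)\big)^{k/C(\Delta)},$$ where $$\delta(U,\varepsilon)=\varepsilon\cdot\exp\Big(-U(1-\varepsilon)+U(0)+\Delta\big(U(\tfrac34)-U(0)\big)\Big),$$ with $\delta(U,\varepsilon)=0$ if $U(1-\varepsilon)=\infty$, and where $C(\Delta)$ depends only on $\Delta$; one may take $C(\Delta)=2^{10\Delta+2}$. -/

import Mathlib

open MeasureTheory
open scoped ENNReal

/-- A potential: an even measurable function `ℝ → (-∞, ∞]` which is finite on a set of positive
Lebesgue measure. -/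
structure Potential where
  /-- the underlying function -/
  toFun : ℝ → EReal
  measurable_toFun : Measurable toFun
  ne_bot : ∀ x, toFun x ≠ ⊥
  finite_pos : 0 < volume {x : ℝ | toFun x < ⊤}
  even : ∀ x, toFun (-x) = toFun x

namespace Potential

instance : CoeFun Potential (fun _ => ℝ → EReal) := ⟨Potential.toFun⟩

/-- `U` is non-decreasing on `[0, ∞)`. -/
def IsMonotone (U : Potential) : Prop :=
  ∀ x y : ℝ, 0 ≤ x → x ≤ y → U x ≤ U y

/-- `U` equals `∞` beyond `1`. -/
def IsLipschitz (U : Potential) : Prop :=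
  ∀ x : ℝ, 1 < x → U x = ⊤

/-- The interaction `U (φ v - φ w)` on the unordered pair `{v, w}`. -/
def edgeEnergy {V : Type*} (U : Potential) (φ : V → ℝ) : Sym2 V → EReal :=
  Sym2.lift ⟨fun v w => U (φ v - φ w), fun v w => by
    show U (φ v - φ w) = U (φ w - φ v)
    rw [← U.even (φ v - φ w), neg_sub]⟩

end Potential

section RandomSurface

variable {V : Type*} [Fintype V]

/-- The reference measure on `V → ℝ`: the product of Dirac masses at `0` on `V₀` and of Lebesgue
measures off `V₀`. -/
noncomputable def surfaceBase (V₀ : Set V) : Measure (V → ℝ) :=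
  open Classical in
  Measure.pi (fun v => if v ∈ V₀ then Measure.dirac (0 : ℝ) else (volume : Measure ℝ))

variable [DecidableEq V]

/-- The unnormalized density `exp (- ∑_{{v, w} ∈ E} U (φ v - φ w))`, with `exp (-∞) = 0`. -/
noncomputable def surfaceWeight (U : Potential) (G : SimpleGraph V) [DecidableRel G.Adj]
    (φ : V → ℝ) : ℝ≥0∞ :=
  EReal.exp (-∑ e ∈ G.edgeFinset, U.edgeEnergy φ e)

/-- The partition function. -/
noncomputable def partitionFunction (U : Potential) (G : SimpleGraph V) [DecidableRel G.Adj]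
    (V₀ : Set V) : ℝ≥0∞ :=
  ∫⁻ φ, surfaceWeight U G φ ∂(surfaceBase V₀)

/-- The random surface measure with potential `U`, normalized to be `0` on `V₀`. -/
noncomputable def surfaceMeasure (U : Potential) (G : SimpleGraph V) [DecidableRel G.Adj]
    (V₀ : Set V) : Measure (V → ℝ) :=
  (partitionFunction U G V₀)⁻¹ • (surfaceBase V₀).withDensity (surfaceWeight U G)

end RandomSurface

/-- `δ(U, ε) = ε * exp (- U(1 - ε) + U(0) + Δ * (U(3/4) - U(0)))`. In extended real arithmetic the
exponent is `-∞`, so that the value is `0`, as soon as `U(1 - ε) = ∞` (even if `U(3/4) = ∞`). -/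
noncomputable def gradientDelta (U : Potential) (Δ : ℕ) (ε : ℝ) : ℝ≥0∞ :=
  ENNReal.ofReal ε *
    EReal.exp (-U (1 - ε) + U 0 + (Δ : EReal) * (U (3 / 4) - U 0))

/-- The constant `C(Δ) = 2 ^ (10 Δ + 2)`. -/
def gradientConst (Δ : ℕ) : ℕ := 2 ^ (10 * Δ + 2)

/-! Fix an independent set `I` of unpinned vertices, each an endpoint of one of the given edges,
with `|I|` at least `k / (Δ (Δ + 1))`. Let `A` be the set of neighbors of `I` and `J` the remaining
vertices. Given the values on `A`, the sites of `I` are independent of each other and of `J`.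
Contract the values on `A` by the factor `1/4` and compare.

At a site of `I`, an extremal gradient confines the value to two intervals of length `ε`. After the
contraction an interval of length `1/2` is available on which all gradients are at most `3/4`. The
ratio of masses is at most `4 δ(U, ε)` (`lintegral_extremal_le`). The change of variables on `A`
costs at most `4 ^ |A| ≤ 4 ^ (Δ |I|)`.

The integral over `J` does not decrease under the contraction (`lmarginal_prod_le_half_smul`). Since
`U` is monotone but perhaps not convex, the weight need not be log-concave. However, each Boltzmann
factor is a superposition of indicators of symmetric intervals. Products of these are indicators of
symmetric convex sets, whose marginals are even and log-concave by Prékopa–Leindler, hence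
non-increasing along rays from the origin.

Thus the event has probability at most `(4 ^ (Δ + 1) δ) ^ |I|`
(`lintegral_extremal_surfaceWeight_le`). -/

/-! ### Layer-cake formula. -/

section LayerCake

theorem lintegral_indicator_ofReal_lt (a : ℝ≥0∞) :
    ∫⁻ r in Set.Ioi (0 : ℝ), (if ENNReal.ofReal r < a then 1 else 0) = a := by
  have hm : MeasurableSet {r : ℝ | ENNReal.ofReal r < a} :=
    measurableSet_lt ENNReal.measurable_ofReal measurable_const
  have : ∀ r : ℝ, (if ENNReal.ofReal r < a then (1 : ℝ≥0∞) else 0) =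
      Set.indicator {r : ℝ | ENNReal.ofReal r < a} 1 r := by
    intro r; simp [Set.indicator_apply]
  simp_rw [this]
  rw [lintegral_indicator_one hm, Measure.restrict_apply hm]
  rcases eq_or_ne a ⊤ with rfl | ha
  · simp
  · have : {r : ℝ | ENNReal.ofReal r < a} ∩ Set.Ioi 0 = Set.Ioo 0 a.toReal := by
      ext r
      simp only [Set.mem_inter_iff, Set.mem_ofPred_eq, Set.mem_Ioi, Set.mem_Ioo]
      constructor
      · rintro ⟨h1, h2⟩; exact ⟨h2, (ENNReal.ofReal_lt_iff_lt_toReal h2.le ha).1 h1⟩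
      · rintro ⟨h1, h2⟩; exact ⟨(ENNReal.ofReal_lt_iff_lt_toReal h1.le ha).2 h2, h1⟩
    rw [this, Real.volume_Ioo, sub_zero, ENNReal.ofReal_toReal ha]

theorem lintegral_eq_lintegral_measure_ofReal_lt {α : Type*} [MeasurableSpace α] (μ : Measure α)
    [SFinite μ] {f : α → ℝ≥0∞} (hf : Measurable f) :
    ∫⁻ x, f x ∂μ = ∫⁻ r in Set.Ioi (0 : ℝ), μ {x | ENNReal.ofReal r < f x} := by
  have h1 : ∀ x, f x = ∫⁻ r in Set.Ioi (0 : ℝ), (if ENNReal.ofReal r < f x then 1 else 0) :=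
    fun x => (lintegral_indicator_ofReal_lt (f x)).symm
  conv_lhs => enter [2, x]; rw [h1 x]
  rw [lintegral_lintegral_swap]
  · refine lintegral_congr fun r => ?_
    have hm : MeasurableSet {x | ENNReal.ofReal r < f x} := measurableSet_lt measurable_const hf
    rw [← lintegral_indicator_one hm]
    refine lintegral_congr fun x => ?_
    simp [Set.indicator_apply]
  · refine (Measurable.ite ?_ measurable_const measurable_const).aemeasurable
    exact measurableSet_lt (ENNReal.measurable_ofReal.comp measurable_snd) (hf.comp measurable_fst)

end LayerCake

/-! ### Brunn–Minkowski inequality on the line. -/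

section BrunnMinkowski

theorem volume_image_half_add (S : Set ℝ) (c : ℝ) :
    volume ((fun x => (x + c) / 2) '' S) = 2⁻¹ * volume S := by
  have : (fun x => (x + c) / 2) = (fun x : ℝ => x + c / 2) ∘ (fun x => (2⁻¹ : ℝ) • x) := by
    ext x; simp; ring
  rw [this, Set.image_comp, Set.image_smul, Set.image_add_right, measure_preimage_add_right,
    Measure.addHaar_smul]
  simp

/-- For compact sets, translate one by the least point of the other and the other by the greatest
point of the first. After halving, both copies lie in `C` and meet in at most one point. Inner
regularity gives the general case. -/
theorem volume_add_volume_le_two_mul {A B C : Set ℝ} (hA : MeasurableSet A)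
    (hB : MeasurableSet B) (hA' : A.Nonempty) (hB' : B.Nonempty)
    (h : ∀ a ∈ A, ∀ b ∈ B, (a + b) / 2 ∈ C) : volume A + volume B ≤ 2 * volume C := by
  have key : ∀ K L : Set ℝ, K ⊆ A → IsCompact K → K.Nonempty → L ⊆ B → IsCompact L →
      L.Nonempty → volume K + volume L ≤ 2 * volume C := by
    intro K L hKA hK hKn hLB hL hLn
    obtain ⟨k, hk, hk'⟩ := hK.exists_isGreatest hKn
    obtain ⟨l, hl, hl'⟩ := hL.exists_isLeast hLn
    set X := (fun x => (x + l) / 2) '' K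
    set Y := (fun x => (x + k) / 2) '' L
    have hY : MeasurableSet Y := (hL.image (by fun_prop)).measurableSet
    have hdis : AEDisjoint volume X Y := by
      refine measure_mono_null (t := {(k + l) / 2}) ?_ (by simp)
      rintro z ⟨⟨x, hx, rfl⟩, ⟨y, hy, hxy⟩⟩
      have := hk' hx
      have := hl' hy
      simp only [Set.mem_singleton_iff] at hxy ⊢
      linarith
    have hsub : X ∪ Y ⊆ C := by
      rintro z (⟨x, hx, rfl⟩ | ⟨y, hy, rfl⟩)
      · exact h _ (hKA hx) _ (hLB hl)
      · have := h _ (hKA hk) _ (hLB hy)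
        rwa [add_comm] at this
    have h1 := measure_mono (μ := volume) hsub
    rw [measure_union₀ hY.nullMeasurableSet hdis, volume_image_half_add, volume_image_half_add,
      ← mul_add] at h1
    calc volume K + volume L = 2 * (2⁻¹ * (volume K + volume L)) := by
          rw [← mul_assoc, ENNReal.mul_inv_cancel (by simp) (by simp), one_mul]
      _ ≤ _ := by gcongr
  obtain ⟨a, ha⟩ := hA'
  obtain ⟨b, hb⟩ := hB'
  rw [hA.measure_eq_iSup_isCompact, hB.measure_eq_iSup_isCompact]
  simp_rw [iSup_and']
  refine ENNReal.biSup_add_biSup_le' ⟨∅, by simp⟩ ⟨∅, by simp⟩ ?_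
  rintro K ⟨hKA, hK⟩ L ⟨hLB, hL⟩
  -- The suprema also range over empty compact sets, to which `key` does not apply. Adding the
  -- points `a` and `b` only enlarges the left side.
  refine le_trans ?_ (key (insert a K) (insert b L) (Set.insert_subset ha hKA) (hK.insert a)
    (Set.insert_nonempty _ _) (Set.insert_subset hb hLB) (hL.insert b) (Set.insert_nonempty _ _))
  gcongr <;> exact Set.subset_insert _ _

end BrunnMinkowski

/-! ### Midpoint Prékopa–Leindler inequality on the line. -/

section PrekopaLeindler

theorem ENNReal.mul_le_sq_of_add_le_two_mul {a b d : ℝ≥0∞} (h : a + b ≤ 2 * d) :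
    a * b ≤ d ^ 2 := by
  rcases eq_or_ne d ⊤ with rfl | hd
  · simp
  have hlt : a + b < ⊤ := h.trans_lt (ENNReal.mul_lt_top (by simp) hd.lt_top)
  have ha : a ≠ ⊤ := fun h' => by simp [h'] at hlt
  have hb : b ≠ ⊤ := fun h' => by simp [h'] at hlt
  lift a to NNReal using ha
  lift b to NNReal using hb
  lift d to NNReal using hd
  norm_cast at h ⊢
  rw [← NNReal.coe_le_coe] at h ⊢
  push_cast at h ⊢
  nlinarith [sq_nonneg ((a : ℝ) - b), a.2, b.2, d.2, mul_self_nonneg ((a : ℝ) + b),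
    mul_le_mul h h (by positivity) (by positivity)]

/-- The midpoint Prékopa–Leindler inequality for a measure on the line. -/
def IsMidpointPrekopa (μ : Measure ℝ) : Prop :=
  ∀ f g h : ℝ → ℝ≥0∞, Measurable f → Measurable g → Measurable h →
    (∀ x y, f x * g y ≤ h ((x + y) / 2) ^ 2) →
    (∫⁻ x, f x ∂μ) * (∫⁻ x, g x ∂μ) ≤ (∫⁻ x, h x ∂μ) ^ 2

theorem isMidpointPrekopa_dirac : IsMidpointPrekopa (Measure.dirac 0) := by
  intro f g h hf hg hh hfg
  rw [lintegral_dirac' _ hf, lintegral_dirac' _ hg, lintegral_dirac' _ hh]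
  simpa using hfg 0 0

/-- With `f` and `g` scaled to supremum `1`, their superlevel sets are nonempty at exactly the same
levels `r < 1`, so Brunn–Minkowski applies level by level. Integrating over `r` gives an additive
inequality, and the arithmetic-geometric mean inequality makes it multiplicative. -/
theorem lintegral_mul_lintegral_le_sq_of_iSup_ne_top {f g h : ℝ → ℝ≥0∞} (hf : Measurable f)
    (hg : Measurable g) (hh : Measurable h) (hfg : ∀ x y, f x * g y ≤ h ((x + y) / 2) ^ 2)
    (hM : ⨆ x, f x ≠ ⊤) (hN : ⨆ x, g x ≠ ⊤) :
    (∫⁻ x, f x) * (∫⁻ x, g x) ≤ (∫⁻ x, h x) ^ 2 := by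
  set M := ⨆ x, f x with hMdef
  set N := ⨆ x, g x with hNdef
  rcases eq_or_ne M 0 with hM0 | hM0
  · have : ∀ x, f x = 0 := fun x => le_antisymm (hM0 ▸ le_iSup f x) bot_le
    simp [this]
  rcases eq_or_ne N 0 with hN0 | hN0
  · have : ∀ x, g x = 0 := fun x => le_antisymm (hN0 ▸ le_iSup g x) bot_le
    simp [this]
  -- The geometric mean of the two suprema is the scaling of `h` that preserves the hypothesis.
  set c := (M * N) ^ (1 / 2 : ℝ) with hc
  have hc2 : c ^ 2 = M * N := by
    rw [hc, ← ENNReal.rpow_natCast, ← ENNReal.rpow_mul]; norm_num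
  have hMN0 : M * N ≠ 0 := mul_ne_zero hM0 hN0
  have hMNt : M * N ≠ ⊤ := ENNReal.mul_ne_top hM hN
  have hc0 : c ≠ 0 := by rintro h0; rw [h0] at hc2; simp at hc2; exact hc2.elim hM0 hN0
  have hct : c ≠ ⊤ := by rintro h0; rw [h0] at hc2; simp at hc2; exact hMNt hc2.symm
  have hsup : ∀ (φ : ℝ → ℝ≥0∞), (⨆ x, φ x) ≠ 0 → (⨆ x, φ x) ≠ ⊤ → ∀ r : ℝ≥0∞, r < 1 →
      ∃ x, r < φ x / ⨆ x, φ x := by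
    intro φ h0 ht r hr
    have : r * (⨆ x, φ x) < ⨆ x, φ x := by
      calc _ < 1 * _ := ENNReal.mul_lt_mul_left h0 ht hr
        _ = _ := one_mul _
    obtain ⟨x, hx⟩ := lt_iSup_iff.1 this
    exact ⟨x, by rwa [ENNReal.lt_div_iff_mul_lt (.inl h0) (.inl ht)]⟩
  have main : (∫⁻ x, f x / M) + (∫⁻ x, g x / N) ≤ 2 * ∫⁻ x, h x / c := by
    rw [lintegral_eq_lintegral_measure_ofReal_lt volume (hf.div_const M),
      lintegral_eq_lintegral_measure_ofReal_lt volume (hg.div_const N),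
      lintegral_eq_lintegral_measure_ofReal_lt volume (hh.div_const c),
      ← lintegral_add_left, ← lintegral_const_mul']
    · refine setLIntegral_mono' measurableSet_Ioi fun r hr => ?_
      rcases lt_or_ge (ENNReal.ofReal r) 1 with hr1 | hr1
      · refine volume_add_volume_le_two_mul
          (measurableSet_lt measurable_const (hf.div_const M))
          (measurableSet_lt measurable_const (hg.div_const N))
          (hsup f hM0 hM _ hr1) (hsup g hN0 hN _ hr1) ?_
        intro x hx y hy
        simp only [Set.mem_ofPred_eq] at hx hy ⊢
        rw [ENNReal.lt_div_iff_mul_lt (.inl hM0) (.inl hM)] at hx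
        rw [ENNReal.lt_div_iff_mul_lt (.inl hN0) (.inl hN)] at hy
        rw [ENNReal.lt_div_iff_mul_lt (.inl hc0) (.inl hct)]
        have h2 : (ENNReal.ofReal r * c) ^ 2 < h ((x + y) / 2) ^ 2 := by
          refine lt_of_lt_of_le ?_ (hfg x y)
          rw [mul_pow, hc2]
          calc _ = (ENNReal.ofReal r * M) * (ENNReal.ofReal r * N) := by ring
            _ < _ := ENNReal.mul_lt_mul hx hy
        exact lt_of_not_ge fun hle => h2.not_ge (by gcongr)
      · have e1 : {x | ENNReal.ofReal r < f x / M} = ∅ := by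
          ext x; simp only [Set.mem_ofPred_eq, Set.mem_empty_iff_false, iff_false, not_lt]
          exact (ENNReal.div_le_of_le_mul (by rw [one_mul]; exact le_iSup f x)).trans hr1
        have e2 : {x | ENNReal.ofReal r < g x / N} = ∅ := by
          ext x; simp only [Set.mem_ofPred_eq, Set.mem_empty_iff_false, iff_false, not_lt]
          exact (ENNReal.div_le_of_le_mul (by rw [one_mul]; exact le_iSup g x)).trans hr1
        simp [e1, e2]
    · simp
    · have : Antitone fun r : ℝ => volume {x | ENNReal.ofReal r < f x / M} := by
        intro r s hrs
        exact measure_mono fun x hx => (ENNReal.ofReal_le_ofReal hrs).trans_lt hx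
      exact this.measurable
  have h3 := ENNReal.mul_le_sq_of_add_le_two_mul main
  simp_rw [div_eq_mul_inv] at h3
  rw [lintegral_mul_const _ hf, lintegral_mul_const _ hg, lintegral_mul_const _ hh, mul_pow,
    ← ENNReal.inv_pow, hc2] at h3
  have h4 : (∫⁻ x, f x) * (∫⁻ x, g x) * (M * N)⁻¹ ≤ (∫⁻ x, h x) ^ 2 * (M * N)⁻¹ := by
    refine le_trans (le_of_eq ?_) h3
    rw [ENNReal.mul_inv (.inl hM0) (.inl hM)]; ring
  rwa [← div_eq_mul_inv, ← div_eq_mul_inv, ENNReal.div_le_iff hMN0 hMNt,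
    ENNReal.div_mul_cancel hMN0 hMNt] at h4

theorem iSup_lintegral_min_natCast {α : Type*} [MeasurableSpace α] (μ : Measure α)
    {f : α → ℝ≥0∞} (hf : Measurable f) :
    ⨆ n : ℕ, ∫⁻ x, min (f x) n ∂μ = ∫⁻ x, f x ∂μ := by
  rw [← lintegral_iSup]
  · refine lintegral_congr fun x => ?_
    have := inf_iSup_eq (f x) (fun n : ℕ => (n : ℝ≥0∞))
    rw [ENNReal.iSup_natCast, inf_top_eq] at this
    exact this.symm
  · intro n; exact hf.min measurable_const
  · intro n m hnm x
    exact min_le_min_left _ (by exact_mod_cast hnm)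

theorem isMidpointPrekopa_volume : IsMidpointPrekopa volume := by
  intro f g h hf hg hh hfg
  rw [← iSup_lintegral_min_natCast volume hf, ← iSup_lintegral_min_natCast volume hg,
    ENNReal.iSup_mul]
  refine iSup_le fun n => ?_
  rw [ENNReal.mul_iSup]
  refine iSup_le fun m => ?_
  refine lintegral_mul_lintegral_le_sq_of_iSup_ne_top (hf.min measurable_const)
    (hg.min measurable_const) hh ?_ ?_ ?_
  · intro x y
    exact (mul_le_mul' (min_le_left _ _) (min_le_left _ _)).trans (hfg x y)
  · exact ne_top_of_le_ne_top (ENNReal.natCast_ne_top n) (iSup_le fun x => min_le_right _ _)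
  · exact ne_top_of_le_ne_top (ENNReal.natCast_ne_top m) (iSup_le fun x => min_le_right _ _)

end PrekopaLeindler

/-! ### Marginals: log-concavity, contraction, factorization, scaling. -/

section LMarginal

variable {V : Type*} [DecidableEq V] {μ : V → Measure ℝ} [∀ i, SigmaFinite (μ i)]

theorem lmarginal_mul_le_sq (hμ : ∀ i, IsMidpointPrekopa (μ i)) {F : (V → ℝ) → ℝ≥0∞}
    (hF : Measurable F) (hF' : ∀ x y, F x * F y ≤ F ((1 / 2 : ℝ) • (x + y)) ^ 2)
    (s : Finset V) (x y : V → ℝ) :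
    lmarginal μ s F x * lmarginal μ s F y ≤ lmarginal μ s F ((1 / 2 : ℝ) • (x + y)) ^ 2 := by
  induction s using Finset.induction generalizing x y with
  | empty => simpa using hF' x y
  | insert i s hi ih =>
    rw [lmarginal_insert _ hF hi, lmarginal_insert _ hF hi, lmarginal_insert _ hF hi]
    have hm := hF.lmarginal μ (s := s)
    refine hμ i _ _ _ (hm.comp (measurable_update x)) (hm.comp (measurable_update y))
      (hm.comp (measurable_update _)) fun a b => ?_
    refine (ih _ _).trans_eq ?_
    congr 2
    ext j
    rcases eq_or_ne j i with rfl | hj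
    · simp; ring
    · simp [hj, mul_add]

theorem lmarginal_neg [∀ i, (μ i).IsNegInvariant] {F : (V → ℝ) → ℝ≥0∞}
    (hF : Measurable F) (hF' : ∀ x, F (-x) = F x) (s : Finset V) (x : V → ℝ) :
    lmarginal μ s F (-x) = lmarginal μ s F x := by
  induction s using Finset.induction generalizing x with
  | empty => simpa using hF' x
  | insert i s hi ih =>
    rw [lmarginal_insert _ hF hi, lmarginal_insert _ hF hi, ← lintegral_neg_eq_self]
    refine lintegral_congr fun t => ?_
    rw [← ih]
    congr 1
    ext j
    rcases eq_or_ne j i with rfl | hj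
    · simp
    · simp [hj]

/-- The marginal `m` is even and midpoint log-concave. The pair `x, -x` gives `m x ≤ m 0`, and the
pair `x, 0` then gives `m x ^ 2 ≤ m x * m 0 ≤ m (x / 2) ^ 2`. -/
theorem lmarginal_le_lmarginal_half_smul (hμ : ∀ i, IsMidpointPrekopa (μ i))
    [∀ i, (μ i).IsNegInvariant] {F : (V → ℝ) → ℝ≥0∞}
    (hF : Measurable F) (hF' : ∀ x y, F x * F y ≤ F ((1 / 2 : ℝ) • (x + y)) ^ 2)
    (hneg : ∀ x, F (-x) = F x) (s : Finset V) (x : V → ℝ) :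
    lmarginal μ s F x ≤ lmarginal μ s F ((1 / 2 : ℝ) • x) := by
  have h0 : lmarginal μ s F x ≤ lmarginal μ s F 0 := by
    have := lmarginal_mul_le_sq hμ hF hF' s x (-x)
    rw [lmarginal_neg hF hneg, ← sq, add_neg_cancel, smul_zero] at this
    exact le_of_not_gt fun h => this.not_gt (ENNReal.pow_lt_pow_left (by norm_num) h)
  have := lmarginal_mul_le_sq hμ hF hF' s x 0
  rw [add_zero] at this
  refine le_of_not_gt fun h => ?_
  have h2 := ENNReal.pow_lt_pow_left (n := 2) (by norm_num) h
  refine (this.trans_lt h2).not_ge ?_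
  rw [sq]
  gcongr

/-- Contracting a configuration by one half increases the marginals of a product of symmetric
decreasing functions of linear functionals. -/
theorem lmarginal_prod_le_half_smul [Finite V] (hμ : ∀ i, IsMidpointPrekopa (μ i))
    [∀ i, (μ i).IsNegInvariant] {ι : Type*} [DecidableEq ι] {h : ℝ → ℝ≥0∞} (hh : Measurable h)
    (hh' : ∀ x y, |x| ≤ |y| → h y ≤ h x) (ℓ : ι → (V → ℝ) →ₗ[ℝ] ℝ) (S : Finset ι)
    (s : Finset V) (x : V → ℝ) :
    lmarginal μ s (fun φ => ∏ i ∈ S, h (ℓ i φ)) x ≤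
      lmarginal μ s (fun φ => ∏ i ∈ S, h (ℓ i φ)) ((1 / 2 : ℝ) • x) := by
  have hℓ : ∀ i, Measurable (ℓ i) := fun i =>
    (LinearMap.continuous_of_finiteDimensional (ℓ i)).measurable
  -- The induction trades the factors one by one, by the layer-cake formula, for indicators of
  -- symmetric convex slabs. The set `K` collects these slabs, so that the base case involves only
  -- the indicator of a symmetric convex set.
  suffices H : ∀ K : Set (V → ℝ), MeasurableSet K → Convex ℝ K → (∀ φ, -φ ∈ K ↔ φ ∈ K) →
      lmarginal μ s (fun φ => K.indicator 1 φ * ∏ i ∈ S, h (ℓ i φ)) x ≤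
      lmarginal μ s (fun φ => K.indicator 1 φ * ∏ i ∈ S, h (ℓ i φ)) ((1 / 2 : ℝ) • x) by
    simpa using H Set.univ MeasurableSet.univ convex_univ (by simp)
  induction S using Finset.induction with
  | empty =>
    intro K hK hconv hsymm
    simp only [Finset.prod_empty, mul_one]
    refine lmarginal_le_lmarginal_half_smul hμ (measurable_one.indicator hK) ?_ ?_ s x
    · intro y z
      by_cases hy : y ∈ K
      · by_cases hz : z ∈ K
        · have : (1 / 2 : ℝ) • (y + z) ∈ K := by
            rw [smul_add]; exact hconv hy hz (by norm_num) (by norm_num) (by norm_num)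
          rw [Set.indicator_of_mem this, Set.indicator_of_mem hy, Set.indicator_of_mem hz]
          simp
        · simp [hz]
      · simp [hy]
    · intro y
      by_cases hy : y ∈ K
      · rw [Set.indicator_of_mem hy, Set.indicator_of_mem ((hsymm y).2 hy)]; rfl
      · rw [Set.indicator_of_notMem hy, Set.indicator_of_notMem (mt (hsymm y).1 hy)]
  | insert e S he ih =>
    intro K hK hconv hsymm
    have hlevel : ∀ r : ℝ, MeasurableSet {φ : V → ℝ | ENNReal.ofReal r < h (ℓ e φ)} := fun r =>
      measurableSet_lt measurable_const (hh.comp (hℓ e))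
    have hprod : Measurable fun φ : V → ℝ => ∏ i ∈ S, h (ℓ i φ) :=
      Finset.measurable_fun_prod _ fun i _ => hh.comp (hℓ i)
    have hcake : ∀ y, lmarginal μ s (fun φ => K.indicator 1 φ * ∏ i ∈ insert e S, h (ℓ i φ)) y =
        ∫⁻ r in Set.Ioi (0 : ℝ), lmarginal μ s (fun φ =>
          (K ∩ {φ | ENNReal.ofReal r < h (ℓ e φ)}).indicator 1 φ * ∏ i ∈ S, h (ℓ i φ)) y := by
      intro y
      have h1 : ∀ φ, K.indicator 1 φ * ∏ i ∈ insert e S, h (ℓ i φ) =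
          ∫⁻ r in Set.Ioi (0 : ℝ), (if ENNReal.ofReal r < h (ℓ e φ) then 1 else 0) *
            (K.indicator 1 φ * ∏ i ∈ S, h (ℓ i φ)) := by
        intro φ
        rw [lintegral_mul_const, lintegral_indicator_ofReal_lt, Finset.prod_insert he]
        · ring
        · exact Measurable.ite (measurableSet_lt ENNReal.measurable_ofReal measurable_const)
            measurable_const measurable_const
      simp_rw [h1]
      unfold lmarginal
      rw [lintegral_lintegral_swap]
      · refine lintegral_congr fun r => lintegral_congr fun φ => ?_
        rw [Set.inter_comm, Set.inter_indicator_one]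
        simp only [Pi.mul_apply, mul_assoc]
        congr 1
        simp [Set.indicator_apply]
      · refine Measurable.aemeasurable ?_
        have hu : Measurable fun p : (s → ℝ) × ℝ => Function.updateFinset y s p.1 :=
          measurable_updateFinset.comp measurable_fst
        refine Measurable.mul ?_ ?_
        · exact Measurable.ite (measurableSet_lt (ENNReal.measurable_ofReal.comp measurable_snd)
            ((hh.comp (hℓ e)).comp hu)) measurable_const measurable_const
        · exact ((measurable_one.indicator hK).mul hprod).comp hu
    rw [hcake, hcake]
    refine lintegral_mono fun r => ih _ (hK.inter (hlevel r)) (hconv.inter ?_) ?_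
    · have hord : Set.OrdConnected {t : ℝ | ENNReal.ofReal r < h t} := by
        refine ⟨fun a ha b hb c hc => ?_⟩
        rcases le_total |a| |b| with hab | hab
        · exact lt_of_lt_of_le hb (hh' _ _ (by
            rw [abs_le]; constructor
            · have := neg_abs_le a; linarith [hc.1]
            · exact hc.2.trans (le_abs_self b)))
        · exact lt_of_lt_of_le ha (hh' _ _ (by
            rw [abs_le]; constructor
            · exact (neg_abs_le a).trans hc.1
            · exact (hc.2.trans (le_abs_self b)).trans hab))
      exact hord.convex.linear_preimage (ℓ e)
    · intro φ
      have heven : h (-(ℓ e φ)) = h (ℓ e φ) :=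
        le_antisymm (hh' _ _ (by simp)) (hh' _ _ (by simp))
      simp [hsymm, heven]

omit [∀ i, SigmaFinite (μ i)] in
theorem lmarginal_mul_of_eqOn {g : (V → ℝ) → ℝ≥0∞} {s : Finset V}
    (hg : ∀ x y : V → ℝ, (∀ i ∉ s, x i = y i) → g x = g y) {f : (V → ℝ) → ℝ≥0∞}
    (hf : Measurable f) (x : V → ℝ) :
    lmarginal μ s (fun φ => g φ * f φ) x = g x * lmarginal μ s f x := by
  have hgx : ∀ y, g (Function.updateFinset x s y) = g x := fun y =>
    hg _ _ fun i hi => by simp [Function.updateFinset, hi]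
  unfold lmarginal
  simp_rw [hgx]
  exact lintegral_const_mul _ (hf.comp measurable_updateFinset)

/-- Fubini for a product of functions each of which depends on its own variable in `s`. -/
theorem lmarginal_prod_eq_prod_lintegral {l : V → (V → ℝ) → ℝ≥0∞} (hl : ∀ v, Measurable (l v))
    (s : Finset V) (hdep : ∀ v ∈ s, ∀ u ∈ s, u ≠ v → ∀ x t, l v (Function.update x u t) = l v x)
    (x : V → ℝ) :
    lmarginal μ s (fun φ => ∏ v ∈ s, l v φ) x =
      ∏ v ∈ s, ∫⁻ t, l v (Function.update x v t) ∂(μ v) := by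
  induction s using Finset.induction generalizing x with
  | empty => simp
  | insert i s hi ih =>
    have hprod : ∀ s : Finset V, Measurable fun φ : V → ℝ => ∏ v ∈ s, l v φ := fun s =>
      Finset.measurable_fun_prod _ fun v _ => hl v
    have hdep' : ∀ t : Finset V, t ⊆ s → ∀ x y : V → ℝ, (∀ j ∉ t, x j = y j) →
        l i x = l i y := by
      intro t
      induction t using Finset.induction with
      | empty => intro _ x y hxy; congr 1; ext j; exact hxy j (by simp)
      | insert j t hj iht =>
        intro hts x y hxy
        have hjs : j ∈ s := hts (Finset.mem_insert_self _ _)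
        have hji : j ≠ i := fun h => hi (h ▸ hjs)
        rw [← hdep i (by simp) j (by simp [hjs]) hji x (y j)]
        refine iht ((Finset.subset_insert _ _).trans hts) _ _ fun k hk => ?_
        rcases eq_or_ne k j with rfl | hkj
        · simp
        · simp [hkj, hxy k (by simp [hkj, hk])]
    rw [lmarginal_insert _ (hprod _) hi, Finset.prod_insert hi]
    simp_rw [Finset.prod_insert hi]
    have : ∀ t, lmarginal μ s (fun φ => l i φ * ∏ v ∈ s, l v φ) (Function.update x i t) =
        l i (Function.update x i t) * ∏ v ∈ s, ∫⁻ t, l v (Function.update x v t) ∂(μ v) := by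
      intro t
      rw [lmarginal_mul_of_eqOn (hdep' s subset_rfl) (hprod s), ih]
      · congr 1
        refine Finset.prod_congr rfl fun v hv => lintegral_congr fun t' => ?_
        have hvi : i ≠ v := fun h => hi (h ▸ hv)
        rw [Function.update_comm hvi, hdep v (by simp [hv]) i (by simp) hvi]
      · intro v hv u hu
        exact hdep v (by simp [hv]) u (by simp [hu])
    simp_rw [this]
    exact lintegral_mul_const _ ((hl i).comp (measurable_update x))

/-- An upper bound in place of a Jacobian identity covers pinned and free coordinates alike, since a
Dirac mass at `0` does not see the scaling. -/
theorem lmarginal_comp_smul_le {c : ℝ} {C : ℝ≥0∞}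
    (hμ : ∀ i, ∀ g : ℝ → ℝ≥0∞, Measurable g → ∫⁻ t, g (c * t) ∂(μ i) ≤ C * ∫⁻ t, g t ∂(μ i))
    {F : (V → ℝ) → ℝ≥0∞} (hF : Measurable F) (s : Finset V) (x : V → ℝ) :
    lmarginal μ s (fun φ => F (c • φ)) x ≤ C ^ s.card * lmarginal μ s F (c • x) := by
  induction s using Finset.induction generalizing x with
  | empty => simp
  | insert i s hi ih =>
    have hm := hF.lmarginal μ (s := s)
    have hc : Measurable fun φ : V → ℝ => F (c • φ) := hF.comp (measurable_const_smul c)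
    rw [lmarginal_insert _ hc hi, lmarginal_insert _ hF hi,
      Finset.card_insert_of_notMem hi]
    calc _ ≤ ∫⁻ t, C ^ s.card * lmarginal μ s F (Function.update (c • x) i (c * t)) ∂(μ i) := by
          refine lintegral_mono fun t => (ih _).trans_eq ?_
          congr 2
          ext j
          rcases eq_or_ne j i with rfl | hj
          · simp
          · simp [hj]
      _ ≤ C * ∫⁻ t, C ^ s.card * lmarginal μ s F (Function.update (c • x) i t) ∂(μ i) :=
          hμ i (fun t => C ^ s.card * lmarginal μ s F (Function.update (c • x) i t))
            ((hm.comp (measurable_update _)).const_mul _)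
      _ = _ := by
          have hu : Measurable fun t => lmarginal μ s F (Function.update (c • x) i t) :=
            hm.comp (measurable_update _)
          rw [lintegral_const_mul _ hu, pow_succ]; ring

end LMarginal

/-! ### Edge gradients and Boltzmann factors. -/

section EdgeDifference

variable {V : Type*}

/-- The difference of a function on the vertices across an edge, with an arbitrary orientation. -/
noncomputable def edgeDiff (e : Sym2 V) : (V → ℝ) →ₗ[ℝ] ℝ :=
  LinearMap.proj (R := ℝ) (φ := fun _ : V => ℝ) (Quot.out e).1 -
    LinearMap.proj (R := ℝ) (φ := fun _ : V => ℝ) (Quot.out e).2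

theorem abs_edgeDiff_mk (v w : V) (φ : V → ℝ) : |edgeDiff s(v, w) φ| = |φ v - φ w| := by
  have h : s((Quot.out s(v, w)).1, (Quot.out s(v, w)).2) = s(v, w) := Quot.out_eq _
  simp only [edgeDiff, LinearMap.sub_apply, LinearMap.proj_apply]
  rcases Sym2.eq_iff.1 h with ⟨h1, h2⟩ | ⟨h1, h2⟩
  · rw [h1, h2]
  · rw [h1, h2, abs_sub_comm]

end EdgeDifference

/-- The value `⊥` must be excluded: `⊥ + ⊤ = ⊥` makes the left side `⊤`, while the product is `⊤ * 0
= 0`. -/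
theorem EReal.exp_neg_sum {ι : Type*} (s : Finset ι) {f : ι → EReal} (hf : ∀ i, f i ≠ ⊥) :
    EReal.exp (-∑ i ∈ s, f i) = ∏ i ∈ s, EReal.exp (-f i) := by
  classical
  induction s using Finset.induction with
  | empty => simp
  | insert a s ha ih =>
    have h0 : EReal.exp (∑ i ∈ s, f i) ≠ 0 := by
      rw [Ne, EReal.exp_eq_zero_iff]
      refine Finset.sum_induction f (· ≠ ⊥) (fun a b ha hb => ?_) (by simp) fun i _ => hf i
      simp [EReal.add_eq_bot_iff, ha, hb]
    have h1 : EReal.exp (f a) ≠ 0 := by simpa using hf a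
    rw [Finset.sum_insert ha, Finset.prod_insert ha, ← ih, EReal.exp_neg, EReal.exp_add,
      ENNReal.mul_inv (.inl h1) (.inr h0), EReal.exp_neg, EReal.exp_neg]

namespace Potential

variable (U : Potential)

/-- The Boltzmann factor `exp (-U x)`. -/
noncomputable def boltzmann (x : ℝ) : ℝ≥0∞ := EReal.exp (-U x)

theorem measurable_boltzmann : Measurable U.boltzmann :=
  U.measurable_toFun.neg.ereal_exp

theorem boltzmann_ne_top (x : ℝ) : U.boltzmann x ≠ ⊤ := by
  simpa [boltzmann, EReal.neg_eq_top_iff] using U.ne_bot x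

theorem boltzmann_eq_zero_iff {x : ℝ} : U.boltzmann x = 0 ↔ U x = ⊤ := by
  simp [boltzmann, EReal.neg_eq_bot_iff]

theorem apply_abs (x : ℝ) : U |x| = U x := by
  rcases abs_choice x with h | h <;> rw [h]
  exact U.even x

variable {U}

theorem IsMonotone.boltzmann_le (hU : U.IsMonotone) {x y : ℝ} (h : |x| ≤ |y|) :
    U.boltzmann y ≤ U.boltzmann x := by
  refine EReal.exp_monotone (EReal.neg_le_neg_iff.2 ?_)
  rw [← U.apply_abs x, ← U.apply_abs y]
  exact hU _ _ (abs_nonneg x) h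

theorem IsLipschitz.boltzmann_eq_zero (hU : U.IsLipschitz) {x : ℝ} (h : 1 < |x|) :
    U.boltzmann x = 0 := by
  rw [U.boltzmann_eq_zero_iff, ← U.apply_abs]
  exact hU _ h

theorem exists_boltzmann_ne_zero (U : Potential) :
    ∃ a : ℝ, 0 < a ∧ U.boltzmann a ≠ 0 := by
  by_contra! H
  refine U.finite_pos.ne' (measure_mono_null (t := {0}) ?_ (by simp))
  intro x hx
  by_contra hx0
  have h1 := H |x| (abs_pos.2 hx0)
  rw [U.boltzmann_eq_zero_iff, U.apply_abs] at h1
  exact (ne_of_lt hx) h1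

/-- The energy comparison which replaces one gradient `1 - ε` by gradients at most `3 / 4`. -/
theorem IsMonotone.boltzmann_mul_le (hU : U.IsMonotone) {Δ d : ℕ} (hd : d + 1 ≤ Δ) {ε : ℝ}
    (hε : ε ≤ 1 / 8) :
    ENNReal.ofReal ε * (U.boltzmann (1 - ε) * U.boltzmann 0 ^ d) ≤
      gradientDelta U Δ ε * U.boltzmann (3 / 4) ^ (d + 1) := by
  rcases eq_or_ne (U (1 - ε)) ⊤ with ha | ha
  · rw [U.boltzmann_eq_zero_iff.2 ha]; simp
  -- As `ε ≤ 1/8`, the point `3/4` lies below `1 - ε`, so finiteness passes down by monotonicity.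
  have hc : U (3 / 4) ≠ ⊤ := ne_top_of_le_ne_top ha (hU _ _ (by norm_num) (by linarith))
  have hb : U 0 ≠ ⊤ := ne_top_of_le_ne_top hc (hU _ _ le_rfl (by norm_num))
  have hbc : U 0 ≤ U (3 / 4) := hU _ _ le_rfl (by norm_num)
  unfold gradientDelta boltzmann
  have ha' := U.ne_bot (1 - ε)
  have hb' := U.ne_bot 0
  have hc' := U.ne_bot (3 / 4)
  generalize U (1 - ε) = a at *
  generalize U 0 = b at *
  generalize U (3 / 4) = c at *
  lift a to ℝ using ⟨ha, ha'⟩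
  lift b to ℝ using ⟨hb, hb'⟩
  lift c to ℝ using ⟨hc, hc'⟩
  rw [EReal.coe_le_coe_iff] at hbc
  have e1 : (-(a : EReal) + b + (Δ : EReal) * (c - b)) = ((-a + b + Δ * (c - b) : ℝ) : EReal) := by
    push_cast; rfl
  rw [e1, ← EReal.coe_neg, ← EReal.coe_neg, ← EReal.coe_neg]
  simp only [EReal.exp_coe]
  rw [mul_assoc]
  refine mul_le_mul' le_rfl ?_
  rw [← ENNReal.ofReal_pow (by positivity), ← ENNReal.ofReal_pow (by positivity),
    ← ENNReal.ofReal_mul (by positivity), ← ENNReal.ofReal_mul (by positivity),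
    ← Real.exp_nat_mul, ← Real.exp_nat_mul, ← Real.exp_add, ← Real.exp_add]
  refine ENNReal.ofReal_le_ofReal (Real.exp_le_exp.2 ?_)
  have hd' : (d : ℝ) + 1 ≤ Δ := by exact_mod_cast hd
  push_cast
  -- The difference of the exponents is `(Δ - d - 1) * (c - b)`, which is nonnegative.
  nlinarith

end Potential

/-! ### The surface measure is well defined. -/

section SurfaceMeasure

variable {V : Type*}

/-- The factor at `v` of the reference measure: `δ₀` on `V₀`, Lebesgue measure off `V₀`. -/
noncomputable def siteMeasure (V₀ : Set V) (v : V) : Measure ℝ :=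
  open Classical in if v ∈ V₀ then Measure.dirac (0 : ℝ) else volume

theorem siteMeasure_of_mem {V₀ : Set V} {v : V} (hv : v ∈ V₀) :
    siteMeasure V₀ v = Measure.dirac 0 := if_pos hv

theorem siteMeasure_of_notMem {V₀ : Set V} {v : V} (hv : v ∉ V₀) :
    siteMeasure V₀ v = volume := if_neg hv

theorem surfaceBase_eq [Fintype V] (V₀ : Set V) :
    surfaceBase V₀ = Measure.pi (siteMeasure V₀) := rfl

variable (V₀ : Set V) (v : V)

instance : SigmaFinite (siteMeasure V₀ v) := by
  by_cases hv : v ∈ V₀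
  · rw [siteMeasure_of_mem hv]; infer_instance
  · rw [siteMeasure_of_notMem hv]; infer_instance

instance : (siteMeasure V₀ v).IsNegInvariant := by
  by_cases hv : v ∈ V₀
  · rw [siteMeasure_of_mem hv]
    refine ⟨?_⟩
    rw [Measure.neg, Measure.map_dirac' measurable_neg, neg_zero]
  · rw [siteMeasure_of_notMem hv]; infer_instance

theorem isMidpointPrekopa_siteMeasure : IsMidpointPrekopa (siteMeasure V₀ v) := by
  by_cases hv : v ∈ V₀
  · rw [siteMeasure_of_mem hv]; exact isMidpointPrekopa_dirac
  · rw [siteMeasure_of_notMem hv]; exact isMidpointPrekopa_volume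

theorem lintegral_siteMeasure_quarter_le {g : ℝ → ℝ≥0∞} (hg : Measurable g) :
    ∫⁻ t, g (1 / 4 * t) ∂(siteMeasure V₀ v) ≤ 4 * ∫⁻ t, g t ∂(siteMeasure V₀ v) := by
  by_cases hv : v ∈ V₀
  · rw [siteMeasure_of_mem hv, lintegral_dirac' _ hg, lintegral_dirac' _ (by fun_prop), mul_zero]
    exact le_mul_of_one_le_left bot_le (by norm_num)
  · rw [siteMeasure_of_notMem hv, ← lintegral_map (g := fun t : ℝ => 1 / 4 * t) hg (by fun_prop),
      Real.map_volume_mul_left (by norm_num), lintegral_smul_measure]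
    norm_num

variable {V₀ v}

theorem ae_surfaceBase_eq_zero [Fintype V] (hv : v ∈ V₀) : ∀ᵐ φ ∂(surfaceBase V₀), φ v = 0 := by
  have h : ∀ᵐ t ∂(siteMeasure V₀ v), t = 0 := by
    rw [siteMeasure_of_mem hv, ae_dirac_eq]; rfl
  exact (Measure.tendsto_eval_ae_ae (μ := siteMeasure V₀) (i := v)).eventually h

variable [Fintype V] [DecidableEq V] {U : Potential} {G : SimpleGraph V} [DecidableRel G.Adj]

omit [Fintype V] [DecidableEq V] in
theorem Potential.IsMonotone.boltzmann_edgeDiff_mk (hU : U.IsMonotone) (a b : V) (φ : V → ℝ) :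
    U.boltzmann (edgeDiff s(a, b) φ) = U.boltzmann (φ a - φ b) :=
  le_antisymm (hU.boltzmann_le (abs_edgeDiff_mk a b φ).ge)
    (hU.boltzmann_le (abs_edgeDiff_mk a b φ).le)

omit [DecidableEq V] in
theorem surfaceWeight_eq_prod (hU : U.IsMonotone) (φ : V → ℝ) :
    surfaceWeight U G φ = ∏ e ∈ G.edgeFinset, U.boltzmann (edgeDiff e φ) := by
  have h : ∀ e, EReal.exp (-U.edgeEnergy φ e) = U.boltzmann (edgeDiff e φ) := by
    intro e
    induction e with | _ a b => rw [hU.boltzmann_edgeDiff_mk]; rfl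
  rw [surfaceWeight, EReal.exp_neg_sum]
  · simp_rw [h]
  · intro e
    induction e with | _ a b => exact U.ne_bot _

omit [DecidableEq V] in
theorem measurable_edgeDiff (e : Sym2 V) : Measurable (edgeDiff e : (V → ℝ) → ℝ) :=
  (LinearMap.continuous_of_finiteDimensional (edgeDiff e)).measurable

theorem surfaceWeight_eq_zero (hU : U.IsMonotone) {φ : V → ℝ} {a b : V} (hab : G.Adj a b)
    (h : U.boltzmann (φ a - φ b) = 0) : surfaceWeight U G φ = 0 := by
  rw [surfaceWeight_eq_prod hU]
  exact Finset.prod_eq_zero (i := s(a, b)) (by simpa using hab)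
    (by rw [hU.boltzmann_edgeDiff_mk, h])

omit [Fintype V] [DecidableEq V] [DecidableRel G.Adj] in
theorem SimpleGraph.Connected.exists_abs_sub_le (hG : G.Connected) (v₀ v : V) :
    ∃ L : ℝ, ∀ φ : V → ℝ, (∀ a b, G.Adj a b → |φ a - φ b| ≤ 1) → |φ v - φ v₀| ≤ L := by
  obtain ⟨p⟩ := hG.preconnected v v₀
  induction p with
  | nil => exact ⟨0, fun φ _ => by simp⟩
  | @cons a b c hab p ih =>
    obtain ⟨L, hL⟩ := ih
    refine ⟨1 + L, fun φ hφ => ?_⟩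
    have h1 := hφ a b hab
    have h2 := hL φ hφ
    calc |φ a - φ c| ≤ |φ a - φ b| + |φ b - φ c| := abs_sub_le _ _ _
      _ ≤ 1 + L := add_le_add h1 h2

/-- Gradients at most `1` and one pinned vertex confine the configuration, along paths of the
connected graph, to a fixed box on which the weight is bounded. -/
theorem partitionFunction_ne_top (hG : G.Connected) (hV₀ : V₀.Nonempty) (hU : U.IsMonotone)
    (hlip : U.IsLipschitz) : partitionFunction U G V₀ ≠ ⊤ := by
  obtain ⟨v₀, hv₀⟩ := hV₀
  choose L hL using hG.exists_abs_sub_le v₀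
  set B : Set (V → ℝ) := Set.univ.pi fun v => Set.Icc (-L v) (L v)
  have hB : surfaceBase V₀ B ≠ ⊤ := by
    rw [surfaceBase_eq, Measure.pi_pi]
    refine ENNReal.prod_ne_top fun v _ => ?_
    by_cases hv : v ∈ V₀
    · rw [siteMeasure_of_mem hv]; exact measure_ne_top _ _
    · rw [siteMeasure_of_notMem hv]; simp
  have hBm : MeasurableSet B := MeasurableSet.univ_pi fun v => measurableSet_Icc
  have hle : ∀ᵐ φ ∂(surfaceBase V₀), surfaceWeight U G φ ≤
      B.indicator (fun _ => U.boltzmann 0 ^ G.edgeFinset.card) φ := by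
    filter_upwards [ae_surfaceBase_eq_zero hv₀] with φ hφ
    by_cases hlipφ : ∀ a b, G.Adj a b → |φ a - φ b| ≤ 1
    · rw [Set.indicator_of_mem]
      · rw [surfaceWeight_eq_prod hU]
        exact Finset.prod_le_pow_card _ _ _ fun e _ => hU.boltzmann_le (by simp)
      · intro v _
        have := hL v φ hlipφ
        rw [hφ, sub_zero] at this
        exact abs_le.1 this
    · push Not at hlipφ
      obtain ⟨a, b, hab, h1⟩ := hlipφ
      rw [surfaceWeight_eq_zero hU hab (hlip.boltzmann_eq_zero h1)]
      exact bot_le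
  refine ne_top_of_le_ne_top ?_ (lintegral_mono_ae hle)
  rw [lintegral_indicator_const hBm]
  exact ENNReal.mul_ne_top (ENNReal.pow_ne_top (U.boltzmann_ne_top 0)) hB

/-- On a cube of side `a` around `0` all gradients are at most `a`, so the weight is bounded below
there. The cube has positive mass because it contains the pinned value `0`. -/
theorem partitionFunction_ne_zero (hU : U.IsMonotone) : partitionFunction U G V₀ ≠ 0 := by
  obtain ⟨a, ha, ha'⟩ := U.exists_boltzmann_ne_zero
  set B : Set (V → ℝ) := Set.univ.pi fun v => Set.Icc (-(a / 2)) (a / 2)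
  have hB : surfaceBase V₀ B ≠ 0 := by
    rw [surfaceBase_eq, Measure.pi_pi]
    refine Finset.prod_ne_zero_iff.2 fun v _ => ?_
    by_cases hv : v ∈ V₀
    · rw [siteMeasure_of_mem hv, Measure.dirac_apply_of_mem]
      · simp
      · constructor <;> linarith
    · rw [siteMeasure_of_notMem hv]
      simp [ha]
  have hBm : MeasurableSet B := MeasurableSet.univ_pi fun v => measurableSet_Icc
  have hle : ∀ φ, B.indicator (fun _ => U.boltzmann a ^ G.edgeFinset.card) φ ≤
      surfaceWeight U G φ := by
    intro φ
    by_cases hφ : φ ∈ B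
    · rw [Set.indicator_of_mem hφ, surfaceWeight_eq_prod hU, ← Finset.prod_const]
      refine Finset.prod_le_prod' fun e _ => ?_
      induction e with
      | _ v w =>
        rw [hU.boltzmann_edgeDiff_mk]
        refine hU.boltzmann_le ?_
        have h1 := hφ v trivial
        have h2 := hφ w trivial
        rw [abs_of_pos ha, abs_le]
        constructor <;> linarith [h1.1, h1.2, h2.1, h2.2]
    · rw [Set.indicator_of_notMem hφ]; exact bot_le
  intro h0
  have := (lintegral_mono hle).trans_eq h0
  rw [lintegral_indicator_const hBm] at this
  exact mul_ne_zero (pow_ne_zero _ ha') hB (le_antisymm this bot_le)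

omit [DecidableEq V] in
theorem surfaceMeasure_apply {S : Set (V → ℝ)} (hS : MeasurableSet S) :
    surfaceMeasure U G V₀ S =
      (partitionFunction U G V₀)⁻¹ * ∫⁻ φ in S, surfaceWeight U G φ ∂(surfaceBase V₀) := by
  rw [surfaceMeasure, Measure.smul_apply, withDensity_apply _ hS, smul_eq_mul]

theorem isProbabilityMeasure_surfaceMeasure (hG : G.Connected) (hV₀ : V₀.Nonempty)
    (hU : U.IsMonotone) (hlip : U.IsLipschitz) :
    IsProbabilityMeasure (surfaceMeasure U G V₀) := by
  refine ⟨?_⟩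
  rw [surfaceMeasure_apply MeasurableSet.univ, setLIntegral_univ]
  exact ENNReal.inv_mul_cancel (partitionFunction_ne_zero hU)
    (partitionFunction_ne_top hG hV₀ hU hlip)

end SurfaceMeasure

/-! ### The single-site estimate. -/

section SingleSite

variable {V : Type*} [DecidableEq V] {U : Potential}

/-- At a single site, the mass of the configurations with an extremal gradient is at most a
multiple of the total mass after the boundary values are contracted. -/
theorem lintegral_extremal_le (hU : U.IsMonotone) (hlip : U.IsLipschitz) {ε : ℝ} (hε0 : 0 < ε)
    (hε : ε ≤ 1 / 8) {Δ : ℕ} {N : Finset V} (hN : N.card ≤ Δ) {w : V} (hw : w ∈ N) (φ : V → ℝ) :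
    ∫⁻ t, {t : ℝ | 1 - ε ≤ |t - φ w|}.indicator 1 t * ∏ u ∈ N, U.boltzmann (t - φ u) ≤
      4 * gradientDelta U Δ ε * ∫⁻ t, ∏ u ∈ N, U.boltzmann (t - 1 / 4 * φ u) := by
  obtain ⟨d, hd⟩ : ∃ d, N.card = d + 1 :=
    ⟨N.card - 1, (Nat.succ_pred_eq_of_pos (Finset.card_pos.2 ⟨w, hw⟩)).symm⟩
  -- If a neighbor differs from `φ w` by more than `2`, no `t` is within `1` of both and the left
  -- side vanishes.
  by_cases hfeas : ∀ u ∈ N, |φ u - φ w| ≤ 2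
  · have hupper : ∀ t, {t : ℝ | 1 - ε ≤ |t - φ w|}.indicator 1 t *
          ∏ u ∈ N, U.boltzmann (t - φ u) ≤
        (Set.Icc (φ w - 1) (φ w - 1 + ε) ∪ Set.Icc (φ w + 1 - ε) (φ w + 1)).indicator
          (fun _ => U.boltzmann (1 - ε) * U.boltzmann 0 ^ d) t := by
      intro t
      by_cases ht : 1 - ε ≤ |t - φ w|
      · by_cases ht1 : |t - φ w| ≤ 1
        · rw [Set.indicator_of_mem (by exact ht), Set.indicator_of_mem, Pi.one_apply, one_mul,
            ← Finset.mul_prod_erase N _ hw]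
          · gcongr
            · exact hU.boltzmann_le (by rwa [abs_of_pos (by linarith)])
            · refine (Finset.prod_le_pow_card _ _ (U.boltzmann 0) fun u _ =>
                hU.boltzmann_le (by simp)).trans_eq ?_
              rw [Finset.card_erase_of_mem hw, hd, Nat.add_sub_cancel]
          · rw [abs_le] at ht1
            rcases le_abs.1 ht with h | h
            · right; constructor <;> linarith [ht1.2]
            · left; constructor <;> linarith [ht1.1]
        · rw [Finset.prod_eq_zero hw (hlip.boltzmann_eq_zero (not_le.1 ht1)), mul_zero]
          exact bot_le
      · rw [Set.indicator_of_notMem (by exact ht), zero_mul]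
        exact bot_le
    -- Contracted neighbors lie within `2 / 4` of `φ w / 4`; a further `1/4` for `t` gives gradients
    -- at most `3/4`.
    have hlower : ∀ t, (Set.Icc (1 / 4 * φ w - 1 / 4) (1 / 4 * φ w + 1 / 4)).indicator
        (fun _ => U.boltzmann (3 / 4) ^ (d + 1)) t ≤
          ∏ u ∈ N, U.boltzmann (t - 1 / 4 * φ u) := by
      intro t
      by_cases ht : t ∈ Set.Icc (1 / 4 * φ w - 1 / 4) (1 / 4 * φ w + 1 / 4)
      · rw [Set.indicator_of_mem ht, ← hd, ← Finset.prod_const]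
        refine Finset.prod_le_prod' fun u hu => hU.boltzmann_le ?_
        have := abs_le.1 (hfeas u hu)
        rw [abs_of_pos (show (0 : ℝ) < 3 / 4 by norm_num), abs_le]
        constructor <;> linarith [ht.1, ht.2, this.1, this.2]
      · rw [Set.indicator_of_notMem ht]; exact bot_le
    calc _ ≤ _ := lintegral_mono hupper
      _ ≤ 2 * (ENNReal.ofReal ε * (U.boltzmann (1 - ε) * U.boltzmann 0 ^ d)) := by
        have hvol : volume (Set.Icc (φ w - 1) (φ w - 1 + ε) ∪ Set.Icc (φ w + 1 - ε) (φ w + 1)) ≤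
            2 * ENNReal.ofReal ε := by
          refine (measure_union_le _ _).trans_eq ?_
          rw [Real.volume_Icc, Real.volume_Icc, two_mul]
          congr 2 <;> ring
        rw [lintegral_indicator_const (measurableSet_Icc.union measurableSet_Icc), mul_comm,
          ← mul_assoc 2]
        exact mul_le_mul' hvol le_rfl
      _ ≤ 2 * (gradientDelta U Δ ε * U.boltzmann (3 / 4) ^ (d + 1)) := by
        gcongr 2 * ?_
        exact hU.boltzmann_mul_le (hd ▸ hN) hε
      _ = 4 * gradientDelta U Δ ε * (U.boltzmann (3 / 4) ^ (d + 1) * ENNReal.ofReal (1 / 2)) := by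
        have : (4 : ℝ≥0∞) * ENNReal.ofReal (1 / 2) = 2 := by
          rw [show (4 : ℝ≥0∞) = ENNReal.ofReal 4 by simp, ← ENNReal.ofReal_mul (by norm_num)]
          norm_num
        rw [← this]; ring
      _ ≤ _ := by
        gcongr
        refine le_trans (le_of_eq ?_) (lintegral_mono hlower)
        rw [lintegral_indicator_const measurableSet_Icc, Real.volume_Icc]
        congr 2
        ring
  · push Not at hfeas
    obtain ⟨u, hu, hu2⟩ := hfeas
    have : ∀ t, ∏ u ∈ N, U.boltzmann (t - φ u) = 0 := by
      intro t
      by_cases ht : 1 < |t - φ w|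
      · exact Finset.prod_eq_zero hw (hlip.boltzmann_eq_zero ht)
      · refine Finset.prod_eq_zero hu (hlip.boltzmann_eq_zero ?_)
        have := abs_sub_le (φ u) t (φ w)
        rw [abs_sub_comm (φ u) t] at this
        linarith
    simp [this]

end SingleSite

/-! ### Contraction around an independent set. -/

section IndependentSites

variable {V : Type*} [Fintype V] [DecidableEq V] {U : Potential} {G : SimpleGraph V}
  [DecidableRel G.Adj] {I : Finset V}

/-- By independence, an edge that meets `I` has exactly one endpoint there, so the stars at the
vertices of `I` partition these edges. -/
theorem surfaceWeight_eq_prod_mul_prod (hU : U.IsMonotone)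
    (hI : ∀ v ∈ I, ∀ u ∈ I, ¬G.Adj v u) (φ : V → ℝ) :
    surfaceWeight U G φ =
      (∏ e ∈ G.edgeFinset with ∀ v ∈ I, v ∉ e, U.boltzmann (edgeDiff e φ)) *
        ∏ v ∈ I, ∏ u ∈ G.neighborFinset v, U.boltzmann (φ v - φ u) := by
  rw [surfaceWeight_eq_prod hU,
    ← Finset.prod_filter_mul_prod_filter_not G.edgeFinset (fun e => ∀ v ∈ I, v ∉ e)]
  congr 1
  have h1 : (G.edgeFinset.filter fun e => ¬∀ v ∈ I, v ∉ e) =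
      I.biUnion fun v => (G.neighborFinset v).image fun u => s(v, u) := by
    ext e
    induction e with | _ a b =>
    simp only [Finset.mem_filter, SimpleGraph.mem_edgeFinset, SimpleGraph.mem_edgeSet, not_forall,
      not_not, Finset.mem_biUnion, Finset.mem_image, SimpleGraph.mem_neighborFinset, Sym2.mem_iff]
    constructor
    · rintro ⟨hab, v, hv, rfl | rfl⟩
      · exact ⟨v, hv, b, hab, rfl⟩
      · exact ⟨v, hv, a, hab.symm, Sym2.eq_swap⟩
    · rintro ⟨v, hv, u, hvu, h⟩
      rcases Sym2.eq_iff.1 h with ⟨rfl, rfl⟩ | ⟨rfl, rfl⟩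
      · exact ⟨hvu, _, hv, .inl rfl⟩
      · exact ⟨hvu.symm, _, hv, .inr rfl⟩
  rw [h1, Finset.prod_biUnion]
  · refine Finset.prod_congr rfl fun v _ => ?_
    rw [Finset.prod_image]
    · simp_rw [hU.boltzmann_edgeDiff_mk]
    · intro a _ b _ hab
      exact Sym2.congr_right.1 hab
  · intro v hv u hu hvu
    rw [Function.onFun, Finset.disjoint_left]
    intro e he he'
    obtain ⟨a, ha, rfl⟩ := Finset.mem_image.1 he
    obtain ⟨b, hb, hab⟩ := Finset.mem_image.1 he'
    rw [SimpleGraph.mem_neighborFinset] at ha hb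
    rcases Sym2.eq_iff.1 hab with ⟨h, -⟩ | ⟨h, -⟩
    · exact hvu h.symm
    · exact hI v hv u hu (h ▸ ha)

variable {V₀ : Set V}

/-- The integral over an independent set of sites and over their neighbors separately. -/
theorem lintegral_edges_mul_sites (hI : ∀ v ∈ I, ∀ u ∈ I, ¬G.Adj v u)
    {l : V → (V → ℝ) → ℝ≥0∞} (hl : ∀ v, Measurable (l v))
    (hdep : ∀ v x y, x v = y v → (∀ u, G.Adj v u → x u = y u) → l v x = l v y) :
    ∫⁻ φ, (∏ e ∈ G.edgeFinset with ∀ v ∈ I, v ∉ e, U.boltzmann (edgeDiff e φ)) *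
        ∏ v ∈ I, l v φ ∂(surfaceBase V₀) =
      lmarginal (siteMeasure V₀) (I.biUnion fun v => G.neighborFinset v) (fun φ =>
        lmarginal (siteMeasure V₀) (Finset.univ \ (I ∪ I.biUnion fun v => G.neighborFinset v))
          (fun φ => ∏ e ∈ G.edgeFinset with ∀ v ∈ I, v ∉ e, U.boltzmann (edgeDiff e φ)) φ *
        ∏ v ∈ I, ∫⁻ t, l v (Function.update φ v t) ∂(siteMeasure V₀ v)) 0 := by
  set W : (V → ℝ) → ℝ≥0∞ := fun φ =>
    ∏ e ∈ G.edgeFinset with ∀ v ∈ I, v ∉ e, U.boltzmann (edgeDiff e φ) with hWdef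
  set A := I.biUnion fun v => G.neighborFinset v with hA
  set J := Finset.univ \ (I ∪ A) with hJ
  have hmemA : ∀ u, u ∈ A ↔ ∃ v ∈ I, G.Adj v u := by simp [hA]
  have hIA : Disjoint I A := by
    rw [Finset.disjoint_left]
    intro u hu hu'
    obtain ⟨v, hv, hvu⟩ := (hmemA u).1 hu'
    exact hI v hv u hu hvu
  have hWm : Measurable W :=
    Finset.measurable_fun_prod _ fun e _ => U.measurable_boltzmann.comp (measurable_edgeDiff e)
  have hlm : Measurable fun φ : V → ℝ => ∏ v ∈ I, l v φ :=
    Finset.measurable_fun_prod _ fun v _ => hl v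
  have hWdep : ∀ x y : V → ℝ, (∀ i ∉ I, x i = y i) → W x = W y := by
    intro x y hxy
    refine Finset.prod_congr rfl fun e he => ?_
    have he' := (Finset.mem_filter.1 he).2
    have h1 := hxy (Quot.out e).1 fun h => he' _ h (Sym2.out_fst_mem e)
    have h2 := hxy (Quot.out e).2 fun h => he' _ h (Sym2.out_snd_mem e)
    simp [edgeDiff, h1, h2]
  have huniv : (Finset.univ : Finset V) = A ∪ (I ∪ J) := by
    ext u
    simp only [hJ, Finset.mem_univ, Finset.mem_union, Finset.mem_sdiff, true_and]
    tauto
  have hd1 : Disjoint I J := by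
    rw [Finset.disjoint_left]; intro u hu; simp [hJ, hu]
  have hd2 : Disjoint A (I ∪ J) := by
    rw [Finset.disjoint_union_right]
    refine ⟨hIA.symm, ?_⟩
    rw [Finset.disjoint_left]; intro u hu; simp [hJ, hu]
  have hm : Measurable fun φ => W φ * ∏ v ∈ I, l v φ := hWm.mul hlm
  rw [surfaceBase_eq, lintegral_eq_lmarginal_univ 0, huniv, lmarginal_union _ _ hm hd2,
    lmarginal_union _ _ hm hd1]
  congr 1
  ext φ
  -- The site factors depend only on `I` and its neighbors, so they leave the integral over `J`. The
  -- factor `W` ignores `I`, so its marginal then leaves the integral over `I`.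
  have hstep : lmarginal (siteMeasure V₀) J (fun φ => W φ * ∏ v ∈ I, l v φ) =
      fun φ => lmarginal (siteMeasure V₀) J W φ * ∏ v ∈ I, l v φ := by
    ext ψ
    simp_rw [mul_comm (W _)]
    rw [lmarginal_mul_of_eqOn _ hWm, mul_comm]
    intro x y hxy
    refine Finset.prod_congr rfl fun v hv => hdep v x y (hxy v ?_) fun u hu => hxy u ?_
    · exact Finset.disjoint_left.1 hd1 hv
    · simp only [hJ, Finset.mem_sdiff, Finset.mem_univ, true_and, not_not, Finset.mem_union]
      exact .inr ((hmemA u).2 ⟨v, hv, hu⟩)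
  rw [hstep, lmarginal_mul_of_eqOn _ hlm, lmarginal_prod_eq_prod_lintegral hl]
  · intro v hv u hu huv x t
    refine hdep v _ _ (by simp [huv.symm]) fun u' hu' => ?_
    have : u' ≠ u := fun h => hI v hv u hu (h ▸ hu')
    simp [this]
  · intro x y hxy
    unfold lmarginal
    refine lintegral_congr fun z => hWdep _ _ fun i hi => ?_
    simp only [Function.updateFinset]
    split_ifs
    · rfl
    · exact hxy i hi

/-- Each site of `I` contributes `4 δ` from the single-site estimate and at most `4 ^ Δ` from
rescaling its neighbors. -/
theorem lintegral_extremal_surfaceWeight_le (hU : U.IsMonotone) (hlip : U.IsLipschitz) {ε : ℝ}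
    (hε0 : 0 < ε) (hε : ε ≤ 1 / 8) (hI : ∀ v ∈ I, ∀ u ∈ I, ¬G.Adj v u)
    (hIV : ∀ v ∈ I, v ∉ V₀) {w : V → V} (hw : ∀ v ∈ I, G.Adj v (w v)) :
    ∫⁻ φ in {φ : V → ℝ | ∀ v ∈ I, 1 - ε ≤ |φ v - φ (w v)|}, surfaceWeight U G φ
        ∂(surfaceBase V₀) ≤
      (4 ^ (G.maxDegree + 1) * gradientDelta U G.maxDegree ε) ^ I.card *
        partitionFunction U G V₀ := by
  set Δ := G.maxDegree
  set W : (V → ℝ) → ℝ≥0∞ := fun φ =>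
    ∏ e ∈ G.edgeFinset with ∀ v ∈ I, v ∉ e, U.boltzmann (edgeDiff e φ) with hWdef
  set A := I.biUnion fun v => G.neighborFinset v with hA
  set J := Finset.univ \ (I ∪ A) with hJ
  let l' : V → (V → ℝ) → ℝ≥0∞ := fun v φ => ∏ u ∈ G.neighborFinset v, U.boltzmann (φ v - φ u)
  -- The adjacency guard makes `S v` depend only on `v` and its neighbors for every `v`, also
  -- outside `I`, where `w v` is arbitrary.
  let S : V → Set (V → ℝ) := fun v => {φ | G.Adj v (w v) → 1 - ε ≤ |φ v - φ (w v)|}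
  let l : V → (V → ℝ) → ℝ≥0∞ := fun v φ => (S v).indicator 1 φ * l' v φ
  have hSm : ∀ v, MeasurableSet (S v) := fun v => by
    by_cases h : G.Adj v (w v)
    · simp only [S, h, true_imp_iff]
      exact measurableSet_le measurable_const (by fun_prop)
    · simp [S, h]
  have hl'm : ∀ v, Measurable (l' v) := fun v =>
    Finset.measurable_fun_prod _ fun u _ => U.measurable_boltzmann.comp (by fun_prop)
  have hlm : ∀ v, Measurable (l v) := fun v => (measurable_one.indicator (hSm v)).mul (hl'm v)
  have hWm : Measurable W :=
    Finset.measurable_fun_prod _ fun e _ => U.measurable_boltzmann.comp (measurable_edgeDiff e)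
  have hl'dep : ∀ v x y, x v = y v → (∀ u, G.Adj v u → x u = y u) → l' v x = l' v y := by
    intro v x y hv hu
    refine Finset.prod_congr rfl fun u hu' => ?_
    rw [hv, hu u (by simpa using hu')]
  have hldep : ∀ v x y, x v = y v → (∀ u, G.Adj v u → x u = y u) → l v x = l v y := by
    intro v x y hv hu
    have hxy : x ∈ S v ↔ y ∈ S v := by
      simp only [S, Set.mem_ofPred_eq]
      refine imp_congr_right fun h => ?_
      rw [hv, hu _ h]
    simp only [l, hl'dep v x y hv hu, Set.indicator_apply, hxy]
    rfl
  let F : (V → ℝ) → ℝ≥0∞ := fun φ => lmarginal (siteMeasure V₀) J W φ *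
    ∏ v ∈ I, ∫⁻ t, l' v (Function.update φ v t) ∂(siteMeasure V₀ v)
  have hFm : Measurable F := by
    refine (hWm.lmarginal _).mul (Finset.measurable_fun_prod _ fun v _ => ?_)
    have := (hl'm v).lmarginal (siteMeasure V₀) (s := {v})
    rwa [lmarginal_singleton] at this
  have hZ : partitionFunction U G V₀ = lmarginal (siteMeasure V₀) A F 0 := by
    rw [partitionFunction, ← lintegral_edges_mul_sites hI hl'm hl'dep]
    exact lintegral_congr (surfaceWeight_eq_prod_mul_prod hU hI)
  have hEvent : ∫⁻ φ in {φ : V → ℝ | ∀ v ∈ I, 1 - ε ≤ |φ v - φ (w v)|}, surfaceWeight U G φ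
        ∂(surfaceBase V₀) = ∫⁻ φ, W φ * ∏ v ∈ I, l v φ ∂(surfaceBase V₀) := by
    have hset : {φ : V → ℝ | ∀ v ∈ I, 1 - ε ≤ |φ v - φ (w v)|} = ⋂ v ∈ I, S v := by
      ext φ
      simp only [S, Set.mem_ofPred_eq, Set.mem_iInter]
      exact forall₂_congr fun v hv => by simp [hw v hv]
    rw [hset, ← lintegral_indicator (Finset.measurableSet_biInter I fun v _ => hSm v)]
    refine lintegral_congr fun φ => ?_
    by_cases hφ : φ ∈ ⋂ v ∈ I, S v
    · rw [Set.indicator_of_mem hφ, surfaceWeight_eq_prod_mul_prod hU hI]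
      congr 1
      refine Finset.prod_congr rfl fun v hv => ?_
      simp only [Set.mem_iInter] at hφ
      simp only [l, Set.indicator_of_mem (hφ v hv), Pi.one_apply, one_mul]
      rfl
    · rw [Set.indicator_of_notMem hφ]
      simp only [Set.mem_iInter, not_forall] at hφ
      obtain ⟨v, hv, hvS⟩ := hφ
      rw [Finset.prod_eq_zero hv, mul_zero]
      simp only [l, Set.indicator_of_notMem hvS, zero_mul]
  have hG : ∀ φ, lmarginal (siteMeasure V₀) J W φ ≤
      lmarginal (siteMeasure V₀) J W ((1 / 4 : ℝ) • φ) := by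
    intro φ
    have h := fun φ => lmarginal_prod_le_half_smul (isMidpointPrekopa_siteMeasure V₀)
      U.measurable_boltzmann (fun x y => hU.boltzmann_le) edgeDiff
      -- Two halvings make the contraction by `1/4`.
      (G.edgeFinset.filter fun e => ∀ v ∈ I, v ∉ e) J φ
    refine ((h φ).trans (h _)).trans_eq ?_
    rw [smul_smul]
    norm_num
    rfl
  have hsite : ∀ v ∈ I, ∀ φ : V → ℝ, ∫⁻ t, l v (Function.update φ v t) ∂(siteMeasure V₀ v) ≤
      4 * gradientDelta U Δ ε *
        ∫⁻ t, l' v (Function.update ((1 / 4 : ℝ) • φ) v t) ∂(siteMeasure V₀ v) := by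
    intro v hv φ
    rw [siteMeasure_of_notMem (hIV v hv)]
    have hne : ∀ u, G.Adj v u → u ≠ v := fun u hu => hu.ne'
    have h1 := lintegral_extremal_le hU hlip hε0 hε (N := G.neighborFinset v) (w := w v)
      (G.degree_le_maxDegree v) (by simpa using hw v hv) φ
    refine (le_of_eq ?_).trans (h1.trans_eq ?_)
    · refine lintegral_congr fun t => ?_
      simp only [l, l']
      congr 1
      · simp [Set.indicator_apply, S, hw v hv, hne _ (hw v hv)]
      · refine Finset.prod_congr rfl fun u hu => ?_
        simp [hne u (by simpa using hu)]
    · congr 1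
      refine lintegral_congr fun t => Finset.prod_congr rfl fun u hu => ?_
      simp [hne u (by simpa using hu)]
  have hcard : A.card ≤ Δ * I.card := by
    rw [mul_comm]
    exact Finset.card_biUnion_le_card_mul _ _ _ fun v _ => G.degree_le_maxDegree v
  rw [hEvent, lintegral_edges_mul_sites hI hlm hldep]
  calc _ ≤ lmarginal (siteMeasure V₀) A
        (fun φ => (4 * gradientDelta U Δ ε) ^ I.card * F ((1 / 4 : ℝ) • φ)) 0 := by
        refine lmarginal_mono (fun φ => ?_) 0
        calc _ ≤ lmarginal (siteMeasure V₀) J W ((1 / 4 : ℝ) • φ) * ∏ v ∈ I,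
              (4 * gradientDelta U Δ ε *
                ∫⁻ t, l' v (Function.update ((1 / 4 : ℝ) • φ) v t) ∂(siteMeasure V₀ v)) :=
              mul_le_mul' (hG φ) (Finset.prod_le_prod' fun v hv => hsite v hv φ)
          _ = _ := by
              rw [Finset.prod_mul_distrib, Finset.prod_const]
              simp only [F]
              ring
    _ = (4 * gradientDelta U Δ ε) ^ I.card *
        lmarginal (siteMeasure V₀) A (fun φ => F ((1 / 4 : ℝ) • φ)) 0 :=
        lmarginal_mul_of_eqOn (g := fun _ => (4 * gradientDelta U Δ ε) ^ I.card)
          (fun _ _ _ => rfl) (hFm.comp (measurable_const_smul _)) 0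
    _ ≤ (4 * gradientDelta U Δ ε) ^ I.card *
        (4 ^ A.card * lmarginal (siteMeasure V₀) A F ((1 / 4 : ℝ) • 0)) := by
        gcongr
        exact lmarginal_comp_smul_le (fun v g hg => lintegral_siteMeasure_quarter_le V₀ v hg)
          hFm A 0
    _ = (4 * gradientDelta U Δ ε) ^ I.card * 4 ^ A.card * partitionFunction U G V₀ := by
        rw [smul_zero, hZ, mul_assoc]
    _ ≤ (4 * gradientDelta U Δ ε) ^ I.card * 4 ^ (Δ * I.card) * partitionFunction U G V₀ := by
        gcongr
        norm_num
    _ = _ := by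
        rw [pow_mul, ← mul_pow]
        ring

end IndependentSites

/-! ### Selecting independent endpoints. -/

section Selection

variable {V : Type*} [Fintype V] [DecidableEq V] (G : SimpleGraph V) [DecidableRel G.Adj]

/-- Every finite set of vertices has an independent subset of comparable size. -/
theorem SimpleGraph.exists_independent_subset (X : Finset V) :
    ∃ I ⊆ X, (∀ v ∈ I, ∀ u ∈ I, ¬G.Adj v u) ∧ X.card ≤ (G.maxDegree + 1) * I.card := by
  obtain ⟨I, hI, hmax⟩ := Finset.exists_max_image
    (X.powerset.filter fun I => ∀ v ∈ I, ∀ u ∈ I, ¬G.Adj v u) Finset.card ⟨∅, by simp⟩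
  rw [Finset.mem_filter, Finset.mem_powerset] at hI
  refine ⟨I, hI.1, hI.2, ?_⟩
  -- A vertex outside this union could be added to `I`, against maximality.
  have hcover : X ⊆ I.biUnion fun v => insert v (G.neighborFinset v) := by
    intro x hx
    by_contra hx'
    simp only [Finset.mem_biUnion, Finset.mem_insert, SimpleGraph.mem_neighborFinset, not_exists,
      not_and, not_or] at hx'
    have hxI : x ∉ I := fun h => (hx' x h).1 rfl
    have := hmax (insert x I) (by
      rw [Finset.mem_filter, Finset.mem_powerset]
      refine ⟨Finset.insert_subset hx hI.1, ?_⟩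
      intro v hv u hu
      rcases Finset.mem_insert.1 hv with rfl | hv' <;>
        rcases Finset.mem_insert.1 hu with rfl | hu'
      · exact G.loopless.irrefl _
      · exact fun h => (hx' u hu').2 h.symm
      · exact (hx' v hv').2
      · exact hI.2 v hv' u hu')
    rw [Finset.card_insert_of_notMem hxI] at this
    omega
  refine (Finset.card_le_card hcover).trans ?_
  rw [mul_comm]
  refine Finset.card_biUnion_le_card_mul _ _ _ fun v _ => (Finset.card_insert_le _ _).trans ?_
  exact Nat.succ_le_succ (G.degree_le_maxDegree v)

/-- Among `k` distinct edges with marked endpoints one can choose marked endpoints which are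
pairwise distinct and non-adjacent, losing only a factor which depends on the maximal degree. -/
theorem SimpleGraph.exists_independent_endpoints {k : ℕ} {x y : Fin k → V}
    (hxy : ∀ i, G.Adj (x i) (y i)) (hinj : Function.Injective fun i => s(x i, y i)) :
    ∃ I : Finset V, (∀ v ∈ I, ∃ i, x i = v) ∧
      (∀ v ∈ I, ∀ u ∈ I, ¬G.Adj v u) ∧
      k ≤ G.maxDegree * ((G.maxDegree + 1) * I.card) := by
  obtain ⟨I, hIX, hI, hcard⟩ := G.exists_independent_subset (Finset.univ.image x)
  refine ⟨I, fun v hv => by simpa using hIX hv, hI, ?_⟩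
  -- Distinct edges with the same marked endpoint have different other endpoints, so at most `Δ`
  -- edges share one.
  have h1 : (Finset.univ : Finset (Fin k)).card ≤ G.maxDegree * (Finset.univ.image x).card := by
    refine Finset.card_le_mul_card_image _ _ fun v _ => ?_
    refine le_trans ?_ (G.degree_le_maxDegree v)
    refine Finset.card_le_card_of_injOn y ?_ ?_
    · intro i hi
      have hi' : x i = v := by simpa using hi
      simpa [← hi'] using hxy i
    · intro i hi j hj hij
      have hi' : x i = v := by simpa using hi
      have hj' : x j = v := by simpa using hj
      exact hinj (by simp only [hi', hj', hij])
  rw [Finset.card_univ, Fintype.card_fin] at h1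
  exact h1.trans (by gcongr)

theorem mul_succ_le_gradientConst (Δ : ℕ) : Δ * (Δ + 1) ≤ gradientConst Δ := by
  have h : Δ < 2 ^ Δ := Nat.lt_two_pow_self
  calc Δ * (Δ + 1) ≤ 2 ^ Δ * 2 ^ Δ := Nat.mul_le_mul h.le h
    _ = 2 ^ (2 * Δ) := by ring
    _ ≤ _ := Nat.pow_le_pow_right (by norm_num) (by omega)

theorem four_pow_le_gradientConst (Δ : ℕ) : 4 ^ (Δ + 1) ≤ gradientConst Δ := by
  rw [show 4 = 2 ^ 2 by norm_num, ← pow_mul]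
  exact Nat.pow_le_pow_right (by norm_num) (by omega)

end Selection

/-! ### The main theorem. -/

theorem theorem1 {V : Type*} [Fintype V] [DecidableEq V]
    (G : SimpleGraph V) [DecidableRel G.Adj] (hG : G.Connected)
    (V₀ : Set V) (hV₀ : V₀.Nonempty)
    (U : Potential) (hmono : U.IsMonotone) (hlip : U.IsLipschitz) :
    IsProbabilityMeasure (surfaceMeasure U G V₀) ∧
    ∀ ε : ℝ, 0 < ε → ε ≤ 1 / 8 →
      ∀ (k : ℕ) (v w : Fin k → V), (∀ i, G.Adj (v i) (w i)) →
        Function.Injective (fun i => s(v i, w i)) →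
        surfaceMeasure U G V₀ {φ : V → ℝ | ∀ i, 1 - ε ≤ |φ (v i) - φ (w i)|} ≤
          ((gradientConst G.maxDegree : ℝ≥0∞) * gradientDelta U G.maxDegree ε) ^
            ((k : ℝ) / (gradientConst G.maxDegree : ℝ)) := by
  have hprob := isProbabilityMeasure_surfaceMeasure hG hV₀ hmono hlip
  refine ⟨hprob, fun ε hε0 hε k v w hvw hinj => ?_⟩
  set Δ := G.maxDegree
  set C := gradientConst Δ
  set δ := gradientDelta U Δ ε
  have hC0 : (0 : ℝ) < C := by simp [C, gradientConst]
  rcases Nat.eq_zero_or_pos k with rfl | hk0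
  · simp
  have : Nonempty (Fin k) := ⟨⟨0, hk0⟩⟩
  -- If the base is at least `1` the bound is trivial. Otherwise powers decrease in the exponent, as
  -- the last step needs.
  rcases le_or_gt 1 ((C : ℝ≥0∞) * δ) with h1 | h1
  · exact prob_le_one.trans (ENNReal.one_le_rpow h1 (by positivity))
  -- An edge with both ends pinned has gradient `0` almost surely, so the event is null. Otherwise
  -- every edge has an unpinned end, which is marked as `p.1`.
  by_cases hV : ∃ i, v i ∈ V₀ ∧ w i ∈ V₀
  · obtain ⟨i, hvi, hwi⟩ := hV
    have hac : surfaceMeasure U G V₀ ≪ surfaceBase V₀ :=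
      (withDensity_absolutelyContinuous _ _).smul_left _
    have hnull : ∀ᵐ φ ∂(surfaceMeasure U G V₀), ¬∀ i, 1 - ε ≤ |φ (v i) - φ (w i)| := by
      filter_upwards [hac.ae_le (ae_surfaceBase_eq_zero hvi),
        hac.ae_le (ae_surfaceBase_eq_zero hwi)] with φ h2 h3 h4
      have := h4 i
      rw [h2, h3, sub_self, abs_zero] at this
      linarith
    rw [ae_iff] at hnull
    simp only [not_not] at hnull
    rw [hnull]
    exact bot_le
  push Not at hV
  have hend : ∀ i, ∃ p : V × V, p.1 ∉ V₀ ∧ G.Adj p.1 p.2 ∧ s(p.1, p.2) = s(v i, w i) ∧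
      ∀ φ : V → ℝ, |φ (v i) - φ (w i)| = |φ p.1 - φ p.2| := by
    intro i
    by_cases hvi : v i ∈ V₀
    · exact ⟨(w i, v i), hV i hvi, (hvw i).symm, Sym2.eq_swap, fun φ => abs_sub_comm _ _⟩
    · exact ⟨(v i, w i), hvi, hvw i, rfl, fun φ => rfl⟩
  choose p hp0 hpadj hps hpabs using hend
  obtain ⟨I, hIp, hI, hk⟩ := G.exists_independent_endpoints hpadj (by simpa only [hps] using hinj)
  choose! i hi using hIp
  have hbound := lintegral_extremal_surfaceWeight_le (V₀ := V₀) hmono hlip hε0 hε hI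
    (fun u hu => hi u hu ▸ hp0 (i u)) (w := fun u => (p (i u)).2)
    (fun u hu => by
      have := hpadj (i u)
      rwa [hi u hu] at this)
  have hm : MeasurableSet {φ : V → ℝ | ∀ u ∈ I, 1 - ε ≤ |φ u - φ (p (i u)).2|} := by
    have : {φ : V → ℝ | ∀ u ∈ I, 1 - ε ≤ |φ u - φ (p (i u)).2|} =
        ⋂ u ∈ I, {φ : V → ℝ | 1 - ε ≤ |φ u - φ (p (i u)).2|} := by
      ext φ; simp
    rw [this]
    exact Finset.measurableSet_biInter I fun u _ =>
      measurableSet_le measurable_const (by fun_prop)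
  have hmain : surfaceMeasure U G V₀ {φ : V → ℝ | ∀ i, 1 - ε ≤ |φ (v i) - φ (w i)|} ≤
      (4 ^ (Δ + 1) * δ) ^ I.card := by
    calc _ ≤ surfaceMeasure U G V₀ {φ : V → ℝ | ∀ u ∈ I, 1 - ε ≤ |φ u - φ (p (i u)).2|} := by
          refine measure_mono fun φ hφ u hu => ?_
          have h2 : 1 - ε ≤ |φ (v (i u)) - φ (w (i u))| := hφ (i u)
          rwa [hpabs, hi u hu] at h2
      _ ≤ (partitionFunction U G V₀)⁻¹ *
          ((4 ^ (Δ + 1) * δ) ^ I.card * partitionFunction U G V₀) := by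
          rw [surfaceMeasure_apply hm]
          gcongr
      _ = _ := by
          rw [mul_comm, mul_assoc, ENNReal.mul_inv_cancel (partitionFunction_ne_zero hmono)
            (partitionFunction_ne_top hG hV₀ hmono hlip), mul_one]
  have hkC : (k : ℝ) / C ≤ I.card := by
    rw [div_le_iff₀ hC0]
    have : k ≤ I.card * C := hk.trans (by
      rw [← mul_assoc, mul_comm]
      exact Nat.mul_le_mul_left _ (mul_succ_le_gradientConst Δ))
    exact_mod_cast this
  calc _ ≤ (4 ^ (Δ + 1) * δ) ^ I.card := hmain
    _ ≤ ((C : ℝ≥0∞) * δ) ^ I.card := by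
        gcongr
        exact_mod_cast four_pow_le_gradientConst Δ
    _ = ((C : ℝ≥0∞) * δ) ^ (I.card : ℝ) := (ENNReal.rpow_natCast _ _).symm
    _ ≤ _ := ENNReal.rpow_le_rpow_of_exponent_ge h1.le hkC
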